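/- Let $R$ be a commutative Artinian ring in which every ideal is principal, and write $E(X)$ for the injective envelope of an $R$-module $X$. Let $M$ be an $R$-module and $E=E(M)$. For an $R$-module $X$ consider the conditions: 1. $X$ is Hopfian (every surjective $R$-endomorphism of $X$ is an automorphism); 2. $X$ is co-Hopfian (every injective $R$-endomorphism of $X$ is an automorphism); 3. $X$ is finitely generated; 4. $X$ has finite length; 5. $X$ is Noetherian (has ACC on submodules); 6. $X$ is Artinian (has DCC on submodules); 7. $X$ is finitely cogenerated, i.e. $E(X)$ is isomorphic to the direct sum of the injective envelopes of finitely many simple $R$-modules. Then each of the conditions 1–7 holds for $X=M$ if and only if it holds for $X=E$. Moreover, the seven conditions are equivalent to one another for $X=M$ (and hence also for $X=E$). -/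

import Mathlib

universe u v w

namespace HopfModules

/-- `M` is Hopfian: every epic (surjective) `R`-module endomorphism is an automorphism. -/
def IsHopfian (R : Type u) (M : Type v) [Ring R] [AddCommGroup M] [Module R M] : Prop :=
  ∀ f : M →ₗ[R] M, Function.Surjective f → Function.Bijective f

/-- `M` is co-Hopfian: every monic (injective) `R`-module endomorphism is an automorphism. -/
def IsCoHopfian (R : Type u) (M : Type v) [Ring R] [AddCommGroup M] [Module R M] : Prop :=
  ∀ f : M →ₗ[R] M, Function.Injective f → Function.Bijective f

/-- `j : M → E` exhibits `E` as an injective envelope of `M`: `E` is an injective module, `j` is a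
monomorphism, and its image is an essential submodule of `E`. The universe of `E` contains that of
`R`, so that `Module.Injective` is injectivity with respect to all `R`-modules. -/
structure IsInjectiveEnvelope {R : Type u} {M : Type v} {E : Type (max u w)} [Ring R]
    [AddCommGroup M] [Module R M] [AddCommGroup E] [Module R E] (j : M →ₗ[R] E) : Prop where
  injective_module : Module.Injective R E
  injective_map : Function.Injective j
  essential : ∀ N : Submodule R E, N ⊓ LinearMap.range j = ⊥ → N = ⊥

/-- `M` is finitely cogenerated: its injective envelope is isomorphic to the direct sum of the
injective envelopes of finitely many simple modules. (Injective envelopes exist and are unique up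
to isomorphism, so it does not matter which ones are taken.) -/
def IsFinitelyCogenerated (R : Type u) (M : Type v) [Ring R] [AddCommGroup M] [Module R M] :
    Prop :=
  ∃ (E : Type (max u v)) (_ : AddCommGroup E) (_ : Module R E) (j : M →ₗ[R] E)
    (n : ℕ)
    (S : Fin n → Type (max u v)) (_ : ∀ i, AddCommGroup (S i)) (_ : ∀ i, Module R (S i))
    (I : Fin n → Type (max u v)) (_ : ∀ i, AddCommGroup (I i)) (_ : ∀ i, Module R (I i))
    (k : ∀ i, S i →ₗ[R] I i),
    IsInjectiveEnvelope.{u, v, v} j ∧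
    (∀ i, IsSimpleModule R (S i)) ∧
    (∀ i, IsInjectiveEnvelope.{u, max u v, v} (k i)) ∧
    Nonempty (E ≃ₗ[R] DirectSum (Fin n) I)

end HopfModules

/-!
The theorem rests on Köthe's decomposition: every module over a commutative Artinian principal
ideal ring `R` is a direct sum of nonzero cyclic modules `R x i`, each killed by a power of a
generator `p` of some maximal ideal (`exists_isCyclicDecomposition`). To see this, split the module
into its `𝔪 ^ n`-torsion submodules, where `n` is a nilpotency exponent of the radical, and let
`p ^ k` kill `M`, where `(p)` is maximal. By induction `p M = ⨁ R y i` with `y i = p x i`, and if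
`T` is a complement of `M[p] ∩ p M` in the semisimple module `M[p]`, then
`M = ⨁ R x i ⊕ T` (`exists_isCyclicDecomposition_of_pow_smul_eq_zero`).

Two features of these summands are used.

* The annihilator of `x i` is a power `𝔪 ^ t` with `t ≤ n`, so only finitely many annihilators
  occur. If there are infinitely many summands, infinitely many of them are isomorphic, and
  shifting these yields a surjective endomorphism that is not injective, and an injective one that
  is not surjective (`finite_of_isHopfian`, `finite_of_isCoHopfian`). Hence both the Hopfian and the
  co-Hopfian modules are exactly the finitely generated ones, and over an Artinian ring finite
  generation, finite length and the two chain conditions agree.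
* Each `R x i` has a smallest nonzero submodule (`exists_generator_minimal_submodule`). If the
  finitely generated `M` is essential in `E = ⨁ R x i`, then `M` meets every `R x i`, so there are
  finitely many summands and `E` is finitely generated (`finite_of_essential`). When moreover `E`
  is injective, so is each `R x i`, which is then the injective envelope of its simple socle
  (`isFinitelyCogenerated_of_finite`).
-/

namespace HopfModules

section CommRing

variable {R : Type u} [CommRing R] {M : Type v} [AddCommGroup M] [Module R M]

/-! ### Direct sums of cyclic modules -/

/-- The family `x` of nonzero elements presents `M` as the internal direct sum of the cyclic
submodules `R ∙ x i`. Independence of these submodules is expressed through coefficients: a linear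
combination of the `x i` vanishes only if each of its terms does. Unlike linear independence, this
allows the `x i` to have nonzero annihilators. -/
structure IsCyclicDecomposition (R : Type u) [CommRing R] {M : Type v} [AddCommGroup M]
    [Module R M] {ι : Type w} (x : ι → M) : Prop where
  ne_zero : ∀ i, x i ≠ 0
  smul_eq_zero : ∀ c : ι →₀ R, Finsupp.linearCombination R x c = 0 → ∀ i, c i • x i = 0
  span_eq_top : Submodule.span R (Set.range x) = ⊤

theorem linearCombination_smul_eq_zero_iff_iSupIndep {ι : Type w} (x : ι → M) :
    (∀ c : ι →₀ R, Finsupp.linearCombination R x c = 0 → ∀ i, c i • x i = 0) ↔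
      iSupIndep fun i => R ∙ x i := by
  classical
  rw [iSupIndep_iff_finsetSum_eq_zero_imp_eq_zero]
  constructor
  · intro h s v hv hsum i hi
    have : ∀ i, ∃ a : R, i ∈ s → a • x i = v i := fun i => by
      by_cases hi : i ∈ s
      · obtain ⟨a, ha⟩ := Submodule.mem_span_singleton.1 (hv i hi)
        exact ⟨a, fun _ => ha⟩
      · exact ⟨0, fun h => absurd h hi⟩
    choose a ha using this
    have h1 := h (Finsupp.onFinset s (fun i => if i ∈ s then a i else 0)
      (fun i hi => by by_contra h; simp [h] at hi)) (by
        rw [Finsupp.linearCombination_apply, Finsupp.onFinset_sum _ (by simp), ← hsum]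
        refine Finset.sum_congr rfl fun i hi => ?_
        simp [hi, ha i hi]) i
    simpa [hi, ha i hi] using h1
  · intro h c hc i
    by_cases hi : i ∈ c.support
    · exact h c.support (fun i => c i • x i)
        (fun i _ => Submodule.smul_mem _ _ (Submodule.mem_span_singleton_self _)) hc i hi
    · simp [Finsupp.notMem_support_iff.1 hi]

namespace IsCyclicDecomposition

variable {ι : Type w} {x : ι → M}

theorem iSupIndep_span_singleton (h : IsCyclicDecomposition R x) :
    iSupIndep fun i => R ∙ x i :=
  (linearCombination_smul_eq_zero_iff_iSupIndep x).1 h.smul_eq_zero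

theorem exists_linearCombination_eq (h : IsCyclicDecomposition R x) (m : M) :
    ∃ c : ι →₀ R, Finsupp.linearCombination R x c = m :=
  (Finsupp.mem_span_range_iff_exists_finsupp).1 (h.span_eq_top ▸ Submodule.mem_top)

theorem finite_module [Finite ι] (h : IsCyclicDecomposition R x) : Module.Finite R M :=
  ⟨h.span_eq_top ▸ Submodule.fg_span (Set.finite_range x)⟩

theorem comp_equiv {κ : Type*} (h : IsCyclicDecomposition R x) (e : κ ≃ ι) :
    IsCyclicDecomposition R (x ∘ e) where
  ne_zero i := h.ne_zero _
  smul_eq_zero := (linearCombination_smul_eq_zero_iff_iSupIndep _).2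
    (h.iSupIndep_span_singleton.comp e.injective)
  span_eq_top := by rw [e.surjective.range_comp, h.span_eq_top]

theorem isInternal [DecidableEq ι] (h : IsCyclicDecomposition R x) :
    DirectSum.IsInternal fun i => R ∙ x i :=
  DirectSum.isInternal_submodule_of_iSupIndep_of_iSup_eq_top h.iSupIndep_span_singleton
    (by rw [← Submodule.span_range_eq_iSup, h.span_eq_top])

/-- A module that is a direct sum of cyclic modules maps out of its generators freely, subject only
to the annihilator conditions. -/
theorem exists_linearMap {N : Type*} [AddCommGroup N] [Module R N] (h : IsCyclicDecomposition R x)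
    (y : ι → N) (hy : ∀ (i) (a : R), a • x i = 0 → a • y i = 0) :
    ∃ f : M →ₗ[R] N, ∀ i, f (x i) = y i := by
  have hsurj : Function.Surjective (Finsupp.linearCombination R x) :=
    h.exists_linearCombination_eq
  have hker : LinearMap.ker (Finsupp.linearCombination R x) ≤
      LinearMap.ker (Finsupp.linearCombination R y) := fun c hc => by
    rw [LinearMap.mem_ker, Finsupp.linearCombination_apply]
    exact Finset.sum_eq_zero fun i _ => hy i _ (h.smul_eq_zero c hc i)
  refine ⟨(Submodule.liftQ _ _ hker) ∘ₗ
    ((Finsupp.linearCombination R x).quotKerEquivOfSurjective hsurj).symm.toLinearMap, fun i => ?_⟩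
  have : ((Finsupp.linearCombination R x).quotKerEquivOfSurjective hsurj).symm (x i) =
      Submodule.Quotient.mk (Finsupp.single i 1) := by
    rw [LinearEquiv.symm_apply_eq]
    simp
  simp [this, Submodule.liftQ_apply]

end IsCyclicDecomposition

/-! ### Modules killed by a power of a generator of a maximal ideal -/

theorem exists_isCyclicDecomposition_of_isSemisimpleModule [IsSemisimpleModule R M] :
    ∃ (ι : Type v) (x : ι → M), IsCyclicDecomposition R x := by
  obtain ⟨s, hs, htop, hsimple⟩ := IsSemisimpleModule.exists_sSupIndep_sSup_simples_eq_top R M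
  have : ∀ S : s, ∃ z : M, z ≠ 0 ∧ R ∙ z = (S : Submodule R M) := fun S => by
    have := hsimple S S.2
    have hat : IsAtom (S : Submodule R M) := isSimpleModule_iff_isAtom.1 this
    obtain ⟨z, hz, hz0⟩ := Submodule.exists_mem_ne_zero_of_ne_bot hat.1
    refine ⟨z, hz0, (hat.le_iff.1 ?_).resolve_left ?_⟩
    · simpa [Submodule.span_le] using hz
    · simpa using hz0
  choose z hz0 hz using this
  refine ⟨s, z, hz0, (linearCombination_smul_eq_zero_iff_iSupIndep _).2 ?_, ?_⟩
  · simp_rw [hz]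
    exact (sSupIndep_iff s).1 hs
  · rw [Submodule.span_range_eq_iSup]
    simp_rw [hz]
    rw [← sSup_eq_iSup', htop]

theorem exists_mul_add_pow_mul_eq_one {p : R} (hp : (Ideal.span {p}).IsMaximal) (k : ℕ) {a : R}
    (ha : ¬ p ∣ a) : ∃ u v : R, u * a + v * p ^ k = 1 := by
  obtain ⟨v, i, hi, h⟩ := hp.exists_inv (mt Ideal.mem_span_singleton.1 ha)
  obtain ⟨w, rfl⟩ := Ideal.mem_span_singleton.1 hi
  have : IsCoprime a p := ⟨v, w, by rw [← h]; ring⟩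
  exact this.pow_right

theorem dvd_of_smul_eq_zero {p : R} (hp : (Ideal.span {p}).IsMaximal) {k : ℕ} {x : M}
    (hx : p ^ k • x = 0) (hx0 : x ≠ 0) {a : R} (ha : a • x = 0) : p ∣ a := by
  by_contra hcon
  obtain ⟨u, v, huv⟩ := exists_mul_add_pow_mul_eq_one hp k hcon
  apply hx0
  rw [← one_smul R x, ← huv, add_smul, mul_smul, mul_smul, ha, hx, smul_zero, smul_zero, add_zero]

/-- Köthe's decomposition in the primary case: generators of `p M` are lifted along multiplication
by `p`, and generators of a complement of `M[p] ∩ p M` in `M[p]` are added to them. -/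
theorem exists_isCyclicDecomposition_of_pow_smul_eq_zero {p : R} (hp : (Ideal.span {p}).IsMaximal)
    (k : ℕ) : ∀ (M : Type v) [AddCommGroup M] [Module R M], (∀ m : M, p ^ k • m = 0) →
      ∃ (ι : Type v) (x : ι → M), IsCyclicDecomposition R x := by
  induction k with
  | zero =>
    intro M _ _ hM
    refine ⟨PEmpty, PEmpty.elim, fun i => i.elim, fun _ _ i => i.elim, ?_⟩
    have : Subsingleton M := ⟨fun a b => by
      have ha := hM a
      have hb := hM b
      simp_all⟩
    exact Subsingleton.elim _ _
  | succ k ih =>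
    intro M _ _ hM
    let P : Submodule R M := LinearMap.range (LinearMap.lsmul R M p)
    let W : Submodule R M := Submodule.torsionBy R M p
    have hP : ∀ m : P, p ^ k • m = 0 := by
      rintro ⟨_, m, rfl⟩
      ext
      simpa [smul_smul, ← pow_succ] using hM m
    obtain ⟨ι, y, hy⟩ := ih P hP
    have hyk : ∀ i, p ^ k • y i = 0 := fun i => hP (y i)
    choose x hx using fun i => (y i).2
    replace hx : ∀ i, p • x i = y i := hx
    -- `M[p]` is a vector space over the field `R ⧸ (p)`
    have hW : IsSemisimpleModule R W := by
      have : Module.IsTorsionBySet R W (Ideal.span {p} : Ideal R) :=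
        (Module.isTorsionBySet_span_singleton_iff p).2 (Submodule.torsionBy_isTorsionBy p)
      let _ := this.module
      let _ := Ideal.Quotient.field (Ideal.span {p})
      exact this.isSemisimpleModule_iff.1 inferInstance
    obtain ⟨T, hT⟩ := exists_isCompl (Submodule.comap W.subtype P)
    obtain ⟨κ, z, hz⟩ := exists_isCyclicDecomposition_of_isSemisimpleModule (R := R) (M := T)
    have hpz : ∀ t : T, p • ((t : W) : M) = 0 := fun t => (t : W).2
    let φ : T →ₗ[R] M := W.subtype ∘ₗ T.subtype
    have hφ : Function.Injective φ := W.injective_subtype.comp T.injective_subtype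
    have hyx : ∀ c : ι →₀ R, ((Finsupp.linearCombination R y c : P) : M) =
        p • Finsupp.linearCombination R x c := fun c => by
      simp only [Finsupp.linearCombination_apply, Finsupp.sum, Finset.smul_sum,
        Submodule.coe_sum, Submodule.coe_smul, ← hx]
      exact Finset.sum_congr rfl fun i _ => smul_comm _ _ _
    have hPx : ∀ m ∈ P, m ∈ Submodule.span R (Set.range x) := fun m hm => by
      obtain ⟨c, hc⟩ := hy.exists_linearCombination_eq ⟨m, hm⟩
      have : m = p • Finsupp.linearCombination R x c := by rw [← hyx, hc]
      rw [this]
      exact Submodule.smul_mem _ _ (Finsupp.mem_span_range_iff_exists_finsupp.2 ⟨c, rfl⟩)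
    refine ⟨ι ⊕ κ, Sum.elim x (fun j => φ (z j)), ?_, ?_, ?_⟩
    · rintro (i | j)
      · intro h0
        exact hy.ne_zero i (Subtype.ext (by rw [← hx i]; simp_all))
      · exact fun h0 => hz.ne_zero j (hφ (by simpa using h0))
    · intro c hc
      obtain ⟨⟨a, b⟩, rfl⟩ := (Finsupp.sumFinsuppLEquivProdFinsupp R).symm.surjective c
      replace hc : Finsupp.linearCombination R x a +
          φ (Finsupp.linearCombination R z b) = 0 := by
        have heq : Finsupp.linearCombination R (Sum.elim x fun j => φ (z j)) =
            ((Finsupp.linearCombination R x).coprod (φ ∘ₗ Finsupp.linearCombination R z)) ∘ₗ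
              (Finsupp.sumFinsuppLEquivProdFinsupp R).toLinearMap := by
          ext (_ | _) <;> simp
        rw [← hc, heq]
        simp
      -- multiplication by `p` kills the part in `T`, and turns the rest into a relation in `p M`
      have ha0 : ∀ i, a i • y i = 0 := hy.smul_eq_zero a <| Subtype.ext <| by
        have h1 := congrArg (p • ·) hc
        have h2 : p • φ (Finsupp.linearCombination R z b) = 0 := hpz _
        simpa [h2, hyx] using h1
      -- since `y i ≠ 0`, the coefficients lie in `(p)`; vanishing ones are divided to `0`, so that
      -- the quotients again have finite support
      have hdvd : ∀ i, ∃ d : R, a i = p * d ∧ (a i = 0 → d = 0) := fun i => by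
        by_cases hi : a i = 0
        · exact ⟨0, by simp [hi], fun _ => rfl⟩
        · obtain ⟨d, hd⟩ := dvd_of_smul_eq_zero hp (hyk i) (hy.ne_zero i) (ha0 i)
          exact ⟨d, hd, fun h => absurd h hi⟩
      choose d hd hd0 using hdvd
      let d' : ι →₀ R := Finsupp.onFinset a.support d fun i hi => by
        simpa using mt (hd0 i) hi
      have hax : Finsupp.linearCombination R x a = Finsupp.linearCombination R y d' := by
        rw [hyx, Finsupp.linearCombination_apply, Finsupp.linearCombination_apply,
          Finsupp.onFinset_sum _ (by simp), Finsupp.sum, Finset.smul_sum]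
        exact Finset.sum_congr rfl fun i _ => by rw [hd i, mul_smul]
      -- `∑ a i x i = ∑ d i y i` lies in `p M`, which meets `T` trivially
      have ht : Finsupp.linearCombination R z b = 0 := by
        have h1 : φ (Finsupp.linearCombination R z b) ∈ P := by
          rw [eq_neg_of_add_eq_zero_right hc, hax]
          exact P.neg_mem (Subtype.property _)
        exact Subtype.ext (Submodule.disjoint_def.1 hT.disjoint _ h1 (Subtype.property _))
      have hd'y : Finsupp.linearCombination R y d' = 0 := by
        rw [ht, map_zero, add_zero, hax] at hc
        exact Subtype.ext hc
      rintro (i | j)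
      · have h1 : d i • (y i : M) = 0 := congrArg Subtype.val (hy.smul_eq_zero d' hd'y i)
        rw [← hx i, smul_smul, mul_comm, ← hd i] at h1
        simpa using h1
      · have h1 := congrArg φ (hz.smul_eq_zero b ht j)
        simpa using h1
    · rw [eq_top_iff, Set.Sum.elim_range, Submodule.span_union]
      intro m _
      obtain ⟨c, hc⟩ := hy.exists_linearCombination_eq ⟨p • m, m, rfl⟩
      have hW : m - Finsupp.linearCombination R x c ∈ W := by
        change p • (m - Finsupp.linearCombination R x c) = 0
        rw [smul_sub, ← hyx, hc, sub_self]
      obtain ⟨u, hu, t, ht, hut⟩ := Submodule.mem_sup.1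
        (hT.sup_eq_top ▸ Submodule.mem_top : (⟨_, hW⟩ : W) ∈ Submodule.comap W.subtype P ⊔ T)
      have hm : m = (u + Finsupp.linearCombination R x c) + t := by
        rw [add_right_comm, ← Submodule.coe_add, hut, sub_add_cancel]
      rw [hm]
      refine Submodule.add_mem_sup (add_mem (hPx _ hu)
        (Finsupp.mem_span_range_iff_exists_finsupp.2 ⟨c, rfl⟩)) ?_
      obtain ⟨b, hb⟩ := hz.exists_linearCombination_eq ⟨t, ht⟩
      refine Finsupp.mem_span_range_iff_exists_finsupp.2 ⟨b, ?_⟩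
      change Finsupp.linearCombination R (φ ∘ z) b = _
      rw [← LinearMap.map_finsupp_linearCombination, hb]
      rfl

/-! ### The decomposition over an Artinian principal ideal ring -/

theorem isCyclicDecomposition_sigma {σ : Type*} {N : σ → Submodule R M} (hN : iSupIndep N)
    (htop : iSup N = ⊤) {ι : σ → Type w} {x : ∀ s, ι s → N s}
    (h : ∀ s, IsCyclicDecomposition R (x s)) :
    IsCyclicDecomposition R fun i : Σ s, ι s => (x i.1 i.2 : M) where
  ne_zero i := by simpa using (h i.1).ne_zero i.2
  smul_eq_zero c hc := by
    have hs : ∀ s, Finsupp.linearCombination R (x s) (c.split s) = 0 := fun s => by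
      by_cases hmem : s ∈ c.splitSupport
      · rw [Finsupp.linearCombination_apply, Finsupp.sigma_sum] at hc
        refine Subtype.ext ((iSupIndep_iff_finsetSum_eq_zero_imp_eq_zero N).1 hN c.splitSupport
          (fun s => (Finsupp.linearCombination R (x s) (c.split s) : M))
          (fun s _ => Subtype.property _) ?_ s hmem)
        rw [← hc]
        refine Finset.sum_congr rfl fun s _ => ?_
        simp [Finsupp.linearCombination_apply, Finsupp.sum]
      · rw [Finsupp.mem_splitSupport_iff_nonzero, not_not] at hmem
        rw [hmem, map_zero]
    rintro ⟨s, i⟩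
    simpa [Finsupp.split_apply] using congrArg Subtype.val ((h s).smul_eq_zero _ (hs s) i)
  span_eq_top := by
    rw [eq_top_iff, ← htop, iSup_le_iff]
    intro s m hm
    obtain ⟨c, hc⟩ := (h s).exists_linearCombination_eq ⟨m, hm⟩
    have : m = Finsupp.linearCombination R ((N s).subtype ∘ x s) c := by
      rw [← LinearMap.map_finsupp_linearCombination, hc]; rfl
    rw [this]
    refine Submodule.span_mono ?_ (Finsupp.mem_span_range_iff_exists_finsupp.2 ⟨c, rfl⟩)
    rintro _ ⟨i, rfl⟩
    exact ⟨⟨s, i⟩, rfl⟩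

/-- `x` is killed by the `n`-th power of a generator of some principal maximal ideal. -/
def IsPrimePowerTorsion (R : Type u) [CommRing R] {M : Type v} [AddCommGroup M] [Module R M]
    (n : ℕ) (x : M) : Prop :=
  ∃ p : R, (Ideal.span {p}).IsMaximal ∧ p ^ n • x = 0

/-- Köthe's theorem: every module over a commutative Artinian principal ideal ring is a direct sum
of primary cyclic modules, with a uniform bound on the exponents. -/
theorem exists_isCyclicDecomposition (R : Type u) [CommRing R] [IsArtinianRing R]
    [IsPrincipalIdealRing R] (M : Type v) [AddCommGroup M] [Module R M] :
    ∃ (n : ℕ) (ι : Type (max u v)) (x : ι → M), IsCyclicDecomposition R x ∧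
      ∀ i, IsPrimePowerTorsion R n (x i) := by
  classical
  have := Fintype.ofFinite (MaximalSpectrum R)
  obtain ⟨n, hn⟩ := IsArtinianRing.isNilpotent_nilradical (R := R)
  choose p hp using fun m : MaximalSpectrum R =>
    (IsPrincipalIdealRing.principal m.asIdeal).principal
  replace hp : ∀ m : MaximalSpectrum R, m.asIdeal = Ideal.span {p m} := hp
  have hpmax : ∀ m, (Ideal.span {p m}).IsMaximal := fun m => hp m ▸ m.isMaximal
  have hcop : ((Finset.univ : Finset (MaximalSpectrum R)) : Set (MaximalSpectrum R)).Pairwise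
      fun i j => i.asIdeal ^ n ⊔ j.asIdeal ^ n = ⊤ := fun i _ j _ hij =>
    Ideal.pow_sup_pow_eq_top
      (Ideal.isMaximal_def.1 i.isMaximal |>.sup_eq_top_of_ne (Ideal.isMaximal_def.1 j.isMaximal)
        (mt MaximalSpectrum.ext hij))
  have hzero : (⨅ m ∈ (Finset.univ : Finset (MaximalSpectrum R)), m.asIdeal ^ n) = ⊥ := by
    rw [← Ideal.zero_eq_bot, ← hn, IsArtinianRing.nilradical_pow_eq_iInf]
    simp
  have hint := Submodule.torsionBySet_isInternal (M := M) hcop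
    (by rw [hzero]; intro m a; simp [(Submodule.mem_bot R).1 a.2])
  have key : ∀ m : (Finset.univ : Finset (MaximalSpectrum R)),
      ∀ y : Submodule.torsionBySet R M (m.1.asIdeal ^ n : Ideal R), p m.1 ^ n • y = 0 := by
    rintro m ⟨y, hy⟩
    ext
    exact (Submodule.mem_torsionBySet_iff _ _).1 hy
      ⟨p m.1 ^ n, Ideal.pow_mem_pow ((hp m.1).symm ▸ Ideal.mem_span_singleton_self _) n⟩
  choose ι x hx using fun m => exists_isCyclicDecomposition_of_pow_smul_eq_zero (hpmax m.1) n _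
    (key m)
  refine ⟨n, _, _, isCyclicDecomposition_sigma hint.submodule_iSupIndep
    hint.submodule_iSup_eq_top hx, fun i => ⟨p i.1.1, hpmax _, ?_⟩⟩
  exact congrArg Subtype.val (key _ (x i.1 i.2))

/-! ### Structure of the primary cyclic summands -/

theorem exists_torsionOf_eq_span_pow {p : R} (hp : (Ideal.span {p}).IsMaximal) (n : ℕ) :
    ∀ x : M, p ^ n • x = 0 → ∃ t ≤ n, Ideal.torsionOf R M x = Ideal.span {p ^ t} := by
  induction n with
  | zero => exact fun x hx => ⟨0, le_rfl, by simp_all⟩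
  | succ n ih =>
    intro x hx
    by_cases hx0 : x = 0
    · exact ⟨0, Nat.zero_le _, by simp [hx0]⟩
    · obtain ⟨t, htn, ht⟩ := ih (p • x) (by rwa [smul_smul, ← pow_succ])
      refine ⟨t + 1, by omega, le_antisymm (fun a ha => ?_) ?_⟩
      · obtain ⟨d, rfl⟩ := dvd_of_smul_eq_zero hp hx hx0 ha
        have hd : d ∈ Ideal.torsionOf R M (p • x) := by
          rw [Ideal.mem_torsionOf_iff] at ha ⊢
          rw [smul_smul, mul_comm, ha]
        rw [ht, Ideal.mem_span_singleton] at hd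
        rw [Ideal.mem_span_singleton, pow_succ']
        exact mul_dvd_mul_left p hd
      · rw [Ideal.span_singleton_le_iff_mem, Ideal.mem_torsionOf_iff, pow_succ, mul_smul]
        exact (Ideal.mem_torsionOf_iff _ _).1 (ht ▸ Ideal.mem_span_singleton_self _)

theorem finite_setOf_torsionOf [Finite (MaximalSpectrum R)] (n : ℕ) :
    {I : Ideal R | ∃ x : M, IsPrimePowerTorsion R n x ∧ Ideal.torsionOf R M x = I}.Finite := by
  refine (Set.finite_range fun a : MaximalSpectrum R × Fin (n + 1) =>
    a.1.asIdeal ^ (a.2 : ℕ)).subset ?_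
  rintro _ ⟨x, ⟨p, hp, hx⟩, rfl⟩
  obtain ⟨t, htn, ht⟩ := exists_torsionOf_eq_span_pow hp n x hx
  exact ⟨(⟨_, hp⟩, ⟨t, by omega⟩), by rw [ht, ← Ideal.span_singleton_pow]⟩

/-- The cyclic module `R ∙ x` has a smallest nonzero submodule `R ∙ y`: up to units, the nonzero
elements of `R ∙ x` are the multiples `p ^ s • x`, and `y` is the last nonzero one. -/
theorem exists_generator_minimal_submodule {p : R} (hp : (Ideal.span {p}).IsMaximal) (n : ℕ) :
    ∀ x : M, p ^ n • x = 0 → x ≠ 0 →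
      ∃ y ∈ R ∙ x, y ≠ 0 ∧ p • y = 0 ∧ ∀ z ∈ R ∙ x, z ≠ 0 → y ∈ R ∙ z := by
  induction n with
  | zero => exact fun x hx hx0 => absurd (by simpa using hx) hx0
  | succ n ih =>
    intro x hx hx0
    -- an element prime to `p` acts invertibly on `R ∙ x`
    have hunit : ∀ a : R, ¬ p ∣ a → x ∈ R ∙ (a • x) := fun a ha => by
      obtain ⟨b, c, hbc⟩ := exists_mul_add_pow_mul_eq_one hp (n + 1) ha
      refine Submodule.mem_span_singleton.2 ⟨b, ?_⟩
      conv_rhs => rw [← one_smul R x, ← hbc, add_smul, mul_smul c, hx, smul_zero, add_zero]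
      rw [smul_smul]
    have hpx : R ∙ (p • x) ≤ R ∙ x := Submodule.span_singleton_smul_le R p x
    by_cases hpx0 : p • x = 0
    · refine ⟨x, Submodule.mem_span_singleton_self x, hx0, hpx0, fun z hz hz0 => ?_⟩
      obtain ⟨a, rfl⟩ := Submodule.mem_span_singleton.1 hz
      refine hunit a ?_
      rintro ⟨d, rfl⟩
      exact hz0 (by rw [mul_comm, mul_smul, hpx0, smul_zero])
    · obtain ⟨y, hy, hy0, hpy, hyz⟩ := ih (p • x) (by rwa [smul_smul, ← pow_succ]) hpx0
      refine ⟨y, hpx hy, hy0, hpy, fun z hz hz0 => ?_⟩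
      obtain ⟨a, rfl⟩ := Submodule.mem_span_singleton.1 hz
      by_cases ha : p ∣ a
      · obtain ⟨d, rfl⟩ := ha
        refine hyz _ (Submodule.mem_span_singleton.2 ⟨d, ?_⟩) hz0
        rw [smul_smul, mul_comm]
      · exact (Submodule.span_singleton_le_iff_mem _ _).2 (hunit a ha) (hpx hy)

theorem isSimpleModule_span_singleton {p : R} (hp : (Ideal.span {p}).IsMaximal) {y : M}
    (hy0 : y ≠ 0) (hpy : p • y = 0) : IsSimpleModule R (R ∙ y) := by
  have h : Ideal.torsionOf R M y = Ideal.span {p} :=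
    (hp.eq_of_le (mt (Ideal.torsionOf_eq_top_iff R y).1 hy0)
      ((Ideal.span_singleton_le_iff_mem _).2 hpy)).symm
  have := (isSimpleModule_iff_isCoatom (R := R) (m := Ideal.torsionOf R M y)).2
    (h ▸ hp.out)
  exact IsSimpleModule.congr (Ideal.quotTorsionOfEquivSpanSingleton R M y).symm

/-! ### Infinitely many summands -/

namespace IsCyclicDecomposition

variable {ι : Type w} {x : ι → M}

/-- Finitely many annihilators occur among primary generators, so among infinitely many generators
infinitely many share one. -/
theorem exists_embedding_torsionOf_eq [Finite (MaximalSpectrum R)] [Infinite ι] {n : ℕ}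
    (hx : ∀ i, IsPrimePowerTorsion R n (x i)) :
    ∃ e : ℕ ↪ ι, ∀ k l, Ideal.torsionOf R M (x (e k)) = Ideal.torsionOf R M (x (e l)) := by
  have : Finite {I : Ideal R | ∃ x : M, IsPrimePowerTorsion R n x ∧ Ideal.torsionOf R M x = I} :=
    finite_setOf_torsionOf n
  obtain ⟨I, hI⟩ := Finite.exists_infinite_fiber fun i =>
    (⟨Ideal.torsionOf R M (x i), x i, hx i, rfl⟩ :
      {I : Ideal R | ∃ x : M, IsPrimePowerTorsion R n x ∧ Ideal.torsionOf R M x = I})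
  let e := Infinite.natEmbedding ((fun i => (⟨Ideal.torsionOf R M (x i), x i, hx i, rfl⟩ :
      {I : Ideal R | ∃ x : M, IsPrimePowerTorsion R n x ∧ Ideal.torsionOf R M x = I})) ⁻¹' {I})
  refine ⟨e.trans (Function.Embedding.subtype _), fun k l => ?_⟩
  exact congrArg Subtype.val ((e k).2.trans (e l).2.symm)

/-- If there were infinitely many summands, the shift `x (e (k + 1)) ↦ x (e k)`, `x (e 0) ↦ 0` along
a sequence of generators with the same annihilator would be surjective but not injective. -/
theorem finite_of_isHopfian (h : IsCyclicDecomposition R x) [Finite (MaximalSpectrum R)] {n : ℕ}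
    (hx : ∀ i, IsPrimePowerTorsion R n (x i)) (hM : IsHopfian R M) : Finite ι := by
  classical
  by_contra hfin
  rw [not_finite_iff_infinite] at hfin
  obtain ⟨e, he⟩ := exists_embedding_torsionOf_eq hx
  let y : ι → M := fun i => if hi : ∃ k, e k = i then
    (if hi.choose = 0 then 0 else x (e (hi.choose - 1))) else x i
  have hye : ∀ k, y (e k) = if k = 0 then 0 else x (e (k - 1)) := fun k => by
    have hk : ∃ l, e l = e k := ⟨k, rfl⟩
    have : hk.choose = k := e.injective hk.choose_spec
    simp only [y, dif_pos hk, this]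
  have hy' : ∀ i, (∀ k, e k ≠ i) → y i = x i := fun i hi => dif_neg (by simpa using hi)
  obtain ⟨f, hf⟩ := h.exists_linearMap y fun i a ha => by
    by_cases hi : ∃ k, e k = i
    · obtain ⟨k, rfl⟩ := hi
      rw [hye]
      split_ifs with hk
      · exact smul_zero a
      · exact (he k (k - 1)).le ha
    · rwa [hy' i (by simpa using hi)]
  have hsurj : Function.Surjective f := by
    rw [← LinearMap.range_eq_top, eq_top_iff, ← h.span_eq_top, Submodule.span_le]
    rintro _ ⟨i, rfl⟩
    by_cases hi : ∃ k, e k = i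
    · obtain ⟨k, rfl⟩ := hi
      exact ⟨x (e (k + 1)), by simp [hf, hye]⟩
    · exact ⟨x i, by rw [hf, hy' i (by simpa using hi)]⟩
  refine h.ne_zero (e 0) ((hM f hsurj).1 ?_)
  rw [hf, hye, if_pos rfl, map_zero]

/-- If there were infinitely many summands, the shift `x (e k) ↦ x (e (k + 1))` along a sequence of
generators with the same annihilator would be injective but miss `x (e 0)`. -/
theorem finite_of_isCoHopfian (h : IsCyclicDecomposition R x) [Finite (MaximalSpectrum R)] {n : ℕ}
    (hx : ∀ i, IsPrimePowerTorsion R n (x i)) (hM : IsCoHopfian R M) : Finite ι := by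
  classical
  by_contra hfin
  rw [not_finite_iff_infinite] at hfin
  obtain ⟨e, he⟩ := exists_embedding_torsionOf_eq hx
  let τ : ι → ι := Function.extend e (fun k => e (k + 1)) id
  have hτe : ∀ k, τ (e k) = e (k + 1) := fun k => e.injective.extend_apply _ _ k
  have hτ' : ∀ i, (¬ ∃ k, e k = i) → τ i = i := fun i hi => Function.extend_apply' _ _ _ hi
  have hτ : Function.Injective τ := fun i i' hii => by
    by_cases hi : ∃ k, e k = i <;> by_cases hi' : ∃ k, e k = i'
    · obtain ⟨k, rfl⟩ := hi
      obtain ⟨l, rfl⟩ := hi'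
      rw [hτe, hτe] at hii
      rw [Nat.succ_injective (e.injective hii)]
    · obtain ⟨k, rfl⟩ := hi
      rw [hτe, hτ' _ hi'] at hii
      exact absurd ⟨_, hii⟩ hi'
    · obtain ⟨k, rfl⟩ := hi'
      rw [hτe, hτ' _ hi] at hii
      exact absurd ⟨_, hii.symm⟩ hi
    · rwa [hτ' _ hi, hτ' _ hi'] at hii
  have h0τ : ∀ i, τ i ≠ e 0 := fun i hi0 => by
    by_cases hi : ∃ k, e k = i
    · obtain ⟨k, rfl⟩ := hi
      rw [hτe] at hi0
      exact Nat.succ_ne_zero k (e.injective hi0)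
    · rw [hτ' _ hi] at hi0
      exact hi ⟨0, hi0.symm⟩
  have hann : ∀ i, Ideal.torsionOf R M (x (τ i)) = Ideal.torsionOf R M (x i) := fun i => by
    by_cases hi : ∃ k, e k = i
    · obtain ⟨k, rfl⟩ := hi
      rw [hτe, he]
    · rw [hτ' _ hi]
  obtain ⟨f, hf⟩ := h.exists_linearMap (x ∘ τ) fun i a ha => (hann i).ge ha
  have hfc : ∀ c : ι →₀ R, f (Finsupp.linearCombination R x c) =
      Finsupp.linearCombination R x (c.mapDomain τ) := fun c => by
    rw [LinearMap.map_finsupp_linearCombination, Finsupp.linearCombination_mapDomain]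
    congr 2
    exact funext hf
  have hinj : Function.Injective f := by
    rw [injective_iff_map_eq_zero]
    intro m hm
    obtain ⟨c, rfl⟩ := h.exists_linearCombination_eq m
    rw [hfc] at hm
    rw [Finsupp.linearCombination_apply]
    refine Finset.sum_eq_zero fun i _ => ?_
    have h1 := h.smul_eq_zero _ hm (τ i)
    rw [Finsupp.mapDomain_apply hτ] at h1
    exact (hann i).le h1
  obtain ⟨m, hm⟩ := (hM f hinj).2 (x (e 0))
  obtain ⟨c, rfl⟩ := h.exists_linearCombination_eq m
  have h1 := h.smul_eq_zero (Finsupp.single (e 0) 1 - c.mapDomain τ)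
    (by rw [map_sub, ← hfc, hm]; simp) (e 0)
  rw [Finsupp.sub_apply, Finsupp.mapDomain_of_notMem_range _ _ (by simpa using h0τ)] at h1
  exact h.ne_zero _ (by simpa using h1)

/-- An essential Noetherian submodule meets every summand nontrivially, and it contains no infinite
independent family of nonzero submodules. -/
theorem finite_of_essential {N : Type*} [AddCommGroup N] [Module R N] [IsNoetherian R N]
    (h : IsCyclicDecomposition R x) (j : N →ₗ[R] M)
    (hess : ∀ P : Submodule R M, P ⊓ LinearMap.range j = ⊥ → P = ⊥) : Finite ι := by
  let Q : Submodule R M := LinearMap.range j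
  have hind : iSupIndep fun i => (R ∙ x i).comap Q.subtype := by
    rw [iSupIndep_iff_finsetSum_eq_zero_imp_eq_zero]
    intro s v hv hsum i hi
    refine Subtype.ext ((iSupIndep_iff_finsetSum_eq_zero_imp_eq_zero _).1
      h.iSupIndep_span_singleton s (fun i => (v i : M)) hv ?_ i hi)
    simpa using congrArg Subtype.val hsum
  refine WellFoundedGT.finite_of_iSupIndep hind fun i hi => ?_
  have hdisj : (R ∙ x i) ⊓ Q = ⊥ := by
    rw [inf_comm, ← Submodule.map_comap_subtype, hi, Submodule.map_bot]
  exact h.ne_zero i (by simpa using hess _ hdisj)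

end IsCyclicDecomposition

/-! ### Finite generation and the seven conditions -/

/-- An essential extension of a finitely generated module is finitely generated. -/
theorem finite_of_essential [IsArtinianRing R] [IsPrincipalIdealRing R] {E : Type w}
    [AddCommGroup E] [Module R E] [Module.Finite R M] (j : M →ₗ[R] E)
    (hess : ∀ P : Submodule R E, P ⊓ LinearMap.range j = ⊥ → P = ⊥) : Module.Finite R E := by
  obtain ⟨n, ι, x, hx, -⟩ := exists_isCyclicDecomposition R E
  have := hx.finite_of_essential j hess
  exact hx.finite_module

theorem isHopfian_iff_finite [IsArtinianRing R] [IsPrincipalIdealRing R] :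
    IsHopfian R M ↔ Module.Finite R M := by
  refine ⟨fun h => ?_, fun _ f hf => ⟨?_, hf⟩⟩
  · obtain ⟨n, ι, x, hx, hn⟩ := exists_isCyclicDecomposition R M
    have := hx.finite_of_isHopfian hn h
    exact hx.finite_module
  · exact OrzechProperty.injective_of_surjective_endomorphism f hf

theorem isCoHopfian_iff_finite [IsArtinianRing R] [IsPrincipalIdealRing R] :
    IsCoHopfian R M ↔ Module.Finite R M := by
  refine ⟨fun h => ?_, fun _ f hf => ?_⟩
  · obtain ⟨n, ι, x, hx, hn⟩ := exists_isCyclicDecomposition R M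
    have := hx.finite_of_isCoHopfian hn h
    exact hx.finite_module
  · exact IsArtinian.bijective_of_injective_endomorphism f hf

theorem finite_of_isFinitelyCogenerated [IsArtinianRing R] [IsPrincipalIdealRing R]
    (h : IsFinitelyCogenerated.{u, v} R M) : Module.Finite R M := by
  obtain ⟨E, _, _, j, n, S, _, _, I, _, _, k, hj, hS, hk, ⟨e⟩⟩ := h
  have : ∀ i, Module.Finite R (I i) := fun i =>
    have := hS i
    finite_of_essential (k i) (hk i).essential
  have : Module.Finite R E := Module.Finite.equiv e.symm
  exact Module.Finite.of_injective j hj.injective_map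

theorem _root_.Module.Injective.of_retract {P Q : Type v} [AddCommGroup P] [Module R P]
    [AddCommGroup Q] [Module R Q] (hQ : Module.Injective R Q) (i : P →ₗ[R] Q) (r : Q →ₗ[R] P)
    (h : r ∘ₗ i = LinearMap.id) : Module.Injective R P where
  out X Y _ _ _ _ f hf g := by
    obtain ⟨g', hg'⟩ := hQ.out f hf (i ∘ₗ g)
    refine ⟨r ∘ₗ g', fun a => ?_⟩
    rw [LinearMap.comp_apply, hg']
    exact LinearMap.congr_fun h (g a)

/-- The summands of a cyclic decomposition of an injective envelope `E` are finitely many, injective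
as direct summands of `E`, and essential over their simple socles. -/
theorem isFinitelyCogenerated_of_finite [IsArtinianRing R] [IsPrincipalIdealRing R]
    {E : Type (max u v)} [AddCommGroup E] [Module R E] [Module.Finite R M]
    (j : M →ₗ[R] E) (hj : IsInjectiveEnvelope.{u, v, v} j) : IsFinitelyCogenerated.{u, v} R M := by
  classical
  obtain ⟨n, ι, x, hx, hxn⟩ := exists_isCyclicDecomposition R E
  have := hx.finite_of_essential j hj.essential
  obtain ⟨l, ⟨e⟩⟩ := Finite.exists_equiv_fin ι
  replace hx := hx.comp_equiv e.symm
  replace hxn : ∀ i, IsPrimePowerTorsion R n ((x ∘ e.symm) i) := fun i => hxn _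
  generalize x ∘ e.symm = x at hx hxn
  choose p hp hpx using hxn
  choose y hy hy0 hpy hyz using fun i =>
    exists_generator_minimal_submodule (hp i) n (x i) (hpx i) (hx.ne_zero i)
  let Φ : DirectSum (Fin l) (fun i => R ∙ x i) ≃ₗ[R] E :=
    LinearEquiv.ofBijective (DirectSum.coeLinearMap fun i => R ∙ x i) hx.isInternal
  refine ⟨E, _, _, j, l, fun i => R ∙ y i, inferInstance, inferInstance, fun i => R ∙ x i,
    inferInstance, inferInstance, fun i => Submodule.inclusion
      ((Submodule.span_singleton_le_iff_mem _ _).2 (hy i)), hj,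
    fun i => isSimpleModule_span_singleton (hp i) (hy0 i) (hpy i), fun i => ⟨?_, ?_, ?_⟩,
    ⟨Φ.symm⟩⟩
  · refine hj.injective_module.of_retract (R ∙ x i).subtype
      (DirectSum.component R (Fin l) _ i ∘ₗ Φ.symm.toLinearMap) ?_
    ext1 z
    have : (z : E) = Φ (DirectSum.lof R _ _ i z) :=
      (DirectSum.coeLinearMap_lof (fun i => R ∙ x i) i z).symm
    simp [this, -LinearEquiv.ofBijective_apply]
  · exact Submodule.inclusion_injective _
  · intro N hN
    by_contra hN0
    obtain ⟨z, hz, hz0⟩ := Submodule.exists_mem_ne_zero_of_ne_bot hN0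
    have hyz := hyz i z z.2 (by simpa using hz0)
    obtain ⟨a, ha⟩ := Submodule.mem_span_singleton.1 hyz
    have : (⟨y i, hy i⟩ : R ∙ x i) ∈ N ⊓ LinearMap.range (Submodule.inclusion
        ((Submodule.span_singleton_le_iff_mem _ _).2 (hy i))) := by
      refine ⟨?_, ⟨y i, Submodule.mem_span_singleton_self _⟩, rfl⟩
      have h1 : (⟨y i, hy i⟩ : R ∙ x i) = a • z := Subtype.ext ha.symm
      rw [h1]
      exact N.smul_mem a hz
    rw [hN, Submodule.mem_bot] at this
    exact hy0 i (congrArg Subtype.val this)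

theorem IsInjectiveEnvelope.id {E : Type (max u v)} [AddCommGroup E] [Module R E]
    (h : Module.Injective R E) :
    IsInjectiveEnvelope.{u, max u v, v} (LinearMap.id : E →ₗ[R] E) where
  injective_module := h
  injective_map := Function.injective_id
  essential N hN := by simpa using hN

end CommRing
end HopfModules

theorem corollary3p10 (R : Type u) [CommRing R] [IsArtinianRing R] [IsPrincipalIdealRing R]
    (M : Type v) [AddCommGroup M] [Module R M]
    (E : Type (max u v)) [AddCommGroup E] [Module R E]
    (j : M →ₗ[R] E) (hj : HopfModules.IsInjectiveEnvelope.{u, v, v} j) :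
    ((HopfModules.IsHopfian R M ↔ HopfModules.IsHopfian R E) ∧
      (HopfModules.IsCoHopfian R M ↔ HopfModules.IsCoHopfian R E) ∧
      (Module.Finite R M ↔ Module.Finite R E) ∧
      (IsFiniteLength R M ↔ IsFiniteLength R E) ∧
      (IsNoetherian R M ↔ IsNoetherian R E) ∧
      (IsArtinian R M ↔ IsArtinian R E) ∧
      (HopfModules.IsFinitelyCogenerated.{u, v} R M ↔
        HopfModules.IsFinitelyCogenerated.{u, max u v} R E)) ∧
    List.TFAE [HopfModules.IsHopfian R M, HopfModules.IsCoHopfian R M, Module.Finite R M,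
      IsFiniteLength R M, IsNoetherian R M, IsArtinian R M,
      HopfModules.IsFinitelyCogenerated.{u, v} R M] := by
  open HopfModules in
  have hME : Module.Finite R M ↔ Module.Finite R E :=
    ⟨fun _ => finite_of_essential j hj.essential,
      fun _ => Module.Finite.of_injective j hj.injective_map⟩
  have hcogM : IsFinitelyCogenerated.{u, v} R M ↔ Module.Finite R M :=
    ⟨finite_of_isFinitelyCogenerated, fun _ => isFinitelyCogenerated_of_finite j hj⟩
  have hcogE : IsFinitelyCogenerated.{u, max u v} R E ↔ Module.Finite R E :=
    ⟨finite_of_isFinitelyCogenerated, fun _ =>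
      isFinitelyCogenerated_of_finite.{u, max u v} _ (.id hj.injective_module)⟩
  have hM := IsArtinianRing.tfae R M
  have hE := IsArtinianRing.tfae R E
  have hM1 : IsNoetherian R M ↔ Module.Finite R M := hM.out 1 0
  have hM2 : IsArtinian R M ↔ Module.Finite R M := hM.out 2 0
  have hM3 : IsFiniteLength R M ↔ Module.Finite R M := hM.out 3 0
  have hE1 : IsNoetherian R E ↔ Module.Finite R E := hE.out 1 0
  have hE2 : IsArtinian R E ↔ Module.Finite R E := hE.out 2 0
  have hE3 : IsFiniteLength R E ↔ Module.Finite R E := hE.out 3 0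
  simp [isHopfian_iff_finite, isCoHopfian_iff_finite, hcogM, hcogE, hM1, hM2, hM3, hE1, hE2, hE3,
    hME, List.tfae_singleton]
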